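/- **Setting.** There are a high-tier stochastic bandit $M_{\rm Hi}$ and $W$ source bandits $M_{{\rm Lo},1},\dots,M_{{\rm Lo},W}$ with the same arms $[A]=\{1,\dots,A\}$. All rewards lie in $[0,1]$ and have means $\mu_{\rm Hi}(i)$, $\mu_{{\rm Lo},w}(i)$; rewards are independent over iterations, tasks and arms. Every task has a unique optimal arm, $i^*_{\rm Hi}$ and $i^*_{{\rm Lo},w}$ respectively. Let $\Delta_{\min}>0$ be the smallest gap $\max_j\mu(j)-\mu(i)$ of a non-optimal arm $i$, over all source tasks and $M_{\rm Hi}$. Assume $\mu_{{\rm Lo},w}(i^*_{{\rm Lo},w})\ge \mu_{\rm Hi}(i^*_{\rm Hi})-\Delta_{\min}/2$ for every $w\in[W]$, and let $0\le\tilde\Delta_{\min}\le\Delta_{\min}$. $M_{\rm Hi}$ and $M_{{\rm Lo},w}$ are called $\epsilon$-close if $\mu_{{\rm Lo},w}(i^*_{{\rm Lo},w})-\mu_{\rm Hi}(i^*_{\rm Hi})\le\epsilon$ and $i^*_{{\rm Lo},w}=i^*_{\rm Hi}$. **Algorithm** (parameters $\alpha>2$ and $\epsilon$). Put $f(k)=1+16WA^2(k+1)^2$.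 In iterations $k=1,\dots,A$ pull arm $k$ in every task; set $w^A=\mathrm{Null}$. For $k>A$ let $N^k_{{\rm Lo},w}(i)$, $N^k_{\rm Hi}(i)$ and $\hat\mu^k_{{\rm Lo},w}(i)$, $\hat\mu^k_{\rm Hi}(i)$ be the numbers of pulls and the empirical means before iteration $k$, and let $\overline\mu^k$, $\underline\mu^k$ be $\hat\mu^k\pm\sqrt{2\alpha\log f(k)/N^k}$. Let $\overline\pi^k_{{\rm Lo},w}$, $\overline\pi^k_{\rm Hi}$ be maximizers of $\overline\mu^k_{{\rm Lo},w}$, $\overline\mu^k_{\rm Hi}$, and $\underline\pi^k_{{\rm Lo},w}$ a maximizer of $\underline\mu^k_{{\rm Lo},w}$ (ties are broken by an arbitrary measurable rule, which may depend on $k$ and the task). Let $$\mathcal I^k=\Big\{w\in[W]:\ \underline\mu^k_{{\rm Lo},w}(\underline\pi^k_{{\rm Lo},w})\le\overline\mu^k_{\rm Hi}(\underline\pi^k_{{\rm Lo},w})+\epsilon,\ \ N^k_{{\rm Lo},w}(\underline\pi^k_{{\rm Lo},w})>k/2\Big\}.$$ If $\mathcal I^k=\emptyset$, set $w^k=\mathrm{Null}$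 and $\pi^k_{\rm Hi}=\overline\pi^k_{\rm Hi}$. Otherwise choose $w^k$ as follows and set $\pi^k_{\rm Hi}=\underline\pi^k_{{\rm Lo},w^k}$: if $w^{k-1}\in\mathcal I^k$, then $w^k=w^{k-1}$; else, if $w^{k-1}\ne\mathrm{Null}$ and some $w\in\mathcal I^k$ has $\pi^{k-1}_{\rm Hi}$ as its most pulled arm $\arg\max_iN^k_{{\rm Lo},w}(i)$, then $w^k$ is such a $w$; else $w^k\sim\mathrm{Unif}(\mathcal I^k)$. Pull $\pi^k_{\rm Hi}$ in $M_{\rm Hi}$ and $\overline\pi^k_{{\rm Lo},w}$ in $M_{{\rm Lo},w}$ for every $w$, and update. **Lemma (Absorbing to similar task).** There are absolute constants $c^*,C>0$ such that the following holds for all $A$, $W$, all tasks as above and all $\alpha>2$. If at least one source task $M_{{\rm Lo},w^*}$ is $\tilde\Delta_{\min}/4$-close to $M_{\rm Hi}$ and the algorithm is run with $\epsilon=\tilde\Delta_{\min}/4$, then for every $$k\ \ge\ k^*:=c^*\,\frac{\alpha A}{\Delta_{\min}^2}\,\log\frac{\alpha AW}{\Delta_{\min}}$$ one has $$\Pr\big(\pi^k_{\rm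 Hi}\ne i^*_{\rm Hi}\big)\ \le\ C\,\frac{A}{k^{2\alpha-2}}.$$ -/

import Mathlib

open MeasureTheory ProbabilityTheory

noncomputable section

namespace TieredBandit

/-- A stochastic bandit with arms `Fin A`: pulling arm `i` yields a reward drawn from `law i`,
a probability distribution on `[0, 1]`. -/
structure Bandit (A : ℕ) where
  law : Fin A → Measure ℝ
  isProb : ∀ i, IsProbabilityMeasure (law i)
  bounded : ∀ i, ∀ᵐ x ∂(law i), x ∈ Set.Icc (0 : ℝ) 1

instance {A : ℕ} (B : Bandit A) (i : Fin A) : IsProbabilityMeasure (B.law i) := B.isProb i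

variable {A W : ℕ}

/-- The expected reward of arm `i`. -/
def Bandit.mean (B : Bandit A) (i : Fin A) : ℝ := ∫ x, x ∂(B.law i)

/-- The optimal value `max_j μ(j)`. -/
def Bandit.optValue (B : Bandit A) : ℝ := ⨆ j, B.mean j

/-- The gap `Δ(i) = max_j μ(j) - μ(i)`. -/
def Bandit.gap (B : Bandit A) (i : Fin A) : ℝ := B.optValue - B.mean i

def Bandit.IsOptimalArm (B : Bandit A) (i : Fin A) : Prop := ∀ j, B.mean j ≤ B.mean i

/-- A tiered bandit problem: one high-tier task and `W` low-tier (source) tasks. -/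
structure Problem (A W : ℕ) where
  hi : Bandit A
  lo : Fin W → Bandit A

/-- All tasks, indexed by `Option (Fin W)`: `none` is the high-tier task and `some w` is the
`w`-th source task. -/
def Problem.task (M : Problem A W) : Option (Fin W) → Bandit A
  | none => M.hi
  | some w => M.lo w

/-- `Δ_min`: the smallest gap of a non-optimal arm, over all the source tasks and the high-tier
task. -/
def Problem.minGap (M : Problem A W) : ℝ :=
  sInf {d : ℝ | ∃ m : Option (Fin W), ∃ i : Fin A,
    ¬ (M.task m).IsOptimalArm i ∧ d = (M.task m).gap i}

/-- Every task has a unique optimal arm. -/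
def Problem.UniqueOptimalArms (M : Problem A W) : Prop :=
  ∀ m, ∃! i, (M.task m).IsOptimalArm i

/-- Optimal value dominance of every source task over the high-tier task. -/
def Problem.OptimalValueDominance (M : Problem A W) : Prop :=
  ∀ w, M.hi.optValue - M.minGap / 2 ≤ (M.lo w).optValue

/-- The high-tier task is `ε`-close to the source task `w`: the optimal value of the source task
exceeds that of the high-tier task by at most `ε`, and both have the same optimal arm. -/
def Problem.IsClose (M : Problem A W) (ε : ℝ) (w : Fin W) : Prop :=
  (M.lo w).optValue - M.hi.optValue ≤ ε ∧
    ∀ i, M.hi.IsOptimalArm i ↔ (M.lo w).IsOptimalArm i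

/-! ### Randomness -/

/-- Nonempty sets of source tasks. -/
abbrev Cand (W : ℕ) : Type := {S : Finset (Fin W) // S.Nonempty}

/-- The randomness of one iteration: the reward which each arm of each task returns if it is
pulled in this iteration, and for each nonempty set of source tasks a random element of it. -/
abbrev Noise (A W : ℕ) : Type :=
  (Option (Fin W) → Fin A → ℝ) × (Cand W → Fin W)

/-- The law of the randomness of one iteration: rewards follow the reward distributions of the
arms, the element drawn from a set is uniform on it, and all draws are independent. -/
def Problem.noiseLaw (M : Problem A W) : Measure (Noise A W) :=
  (Measure.pi fun m => Measure.pi fun i => (M.task m).law i).prod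
    (Measure.pi fun S : Cand W => (PMF.uniformOfFinset S.1 S.2).toMeasure)

instance (M : Problem A W) : IsProbabilityMeasure M.noiseLaw := by
  unfold Problem.noiseLaw
  infer_instance

/-- The law of the randomness of all iterations (independent over iterations); the coordinate
`ω k` belongs to iteration `k = 1, 2, …`. -/
def Problem.P (M : Problem A W) : Measure (ℕ → Noise A W) :=
  Measure.infinitePi fun _ => M.noiseLaw

instance (M : Problem A W) : IsProbabilityMeasure M.P := by
  unfold Problem.P
  infer_instance

/-! ### The algorithm -/

/-- The choices which the pseudocode leaves open: which maximizer an `argmax` returns (for the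
upper and for the lower confidence bounds), and which of several source tasks is taken when the
previous action is inherited. -/
structure TieBreak (A W : ℕ) where
  upper : ℕ → Option (Fin W) → (Fin A → ℝ) → Fin A
  upper_measurable : ∀ k m, Measurable (upper k m)
  upper_max : ∀ k m (v : Fin A → ℝ) i, v i ≤ v (upper k m v)
  lower : ℕ → Fin W → (Fin A → ℝ) → Fin A
  lower_measurable : ∀ k w, Measurable (lower k w)
  lower_max : ∀ k w (v : Fin A → ℝ) i, v i ≤ v (lower k w v)
  inherit : ℕ → Cand W → Fin W
  inherit_mem : ∀ k S, inherit k S ∈ S.1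

/-- The memory of the algorithm between two iterations: number of pulls and sum of rewards of
each arm in each task, and the trusted source task (`none` for `Null`) and the high-tier arm of
the last iteration. -/
structure State (A W : ℕ) where
  count : Option (Fin W) → Fin A → ℕ
  total : Option (Fin W) → Fin A → ℝ
  prevTask : Option (Fin W)
  prevArm : Option (Fin A)

def State.initial : State A W := ⟨fun _ _ => 0, fun _ _ => 0, none, none⟩

/-- `f(k) = 1 + 16 W A² (k+1)²`. -/
def confLevel (A W k : ℕ) : ℝ := 1 + 16 * W * (A : ℝ) ^ 2 * ((k : ℝ) + 1) ^ 2

/-- Empirical mean reward. -/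
def State.empMean (s : State A W) (m : Option (Fin W)) (i : Fin A) : ℝ :=
  s.total m i / s.count m i

/-- The confidence width `√(2 α log f(k) / N(i))`. -/
def State.width (s : State A W) (α : ℝ) (k : ℕ) (m : Option (Fin W)) (i : Fin A) : ℝ :=
  √(2 * α * Real.log (confLevel A W k) / s.count m i)

def State.ucb (s : State A W) (α : ℝ) (k : ℕ) (m : Option (Fin W)) (i : Fin A) : ℝ :=
  s.empMean m i + s.width α k m i

def State.lcb (s : State A W) (α : ℝ) (k : ℕ) (m : Option (Fin W)) (i : Fin A) : ℝ :=
  s.empMean m i - s.width α k m i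

/-- The arm with the largest upper confidence bound in task `m`. -/
def State.upperArm (s : State A W) (τ : TieBreak A W) (α : ℝ) (k : ℕ) (m : Option (Fin W)) :
    Fin A :=
  τ.upper k m (s.ucb α k m)

/-- The arm with the largest lower confidence bound in source task `w`. -/
def State.lowerArm (s : State A W) (τ : TieBreak A W) (α : ℝ) (k : ℕ) (w : Fin W) : Fin A :=
  τ.lower k w (s.lcb α k (some w))

open Classical in
/-- The set `𝓘ᵏ` of source tasks that pass the checking event. -/
def State.passing (s : State A W) (τ : TieBreak A W) (α ε : ℝ) (k : ℕ) : Finset (Fin W) :=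
  Finset.univ.filter fun w =>
    s.lcb α k (some w) (s.lowerArm τ α k w) ≤ s.ucb α k none (s.lowerArm τ α k w) + ε ∧
      (k : ℝ) / 2 < s.count (some w) (s.lowerArm τ α k w)

open Classical in
/-- The tasks of `𝓘ᵏ` whose most pulled arm is the high-tier arm of the last iteration. -/
def State.inheriting (s : State A W) (τ : TieBreak A W) (α ε : ℝ) (k : ℕ) : Finset (Fin W) :=
  (s.passing τ α ε k).filter fun w =>
    ∃ a, s.prevArm = some a ∧ ∀ j, s.count (some w) j ≤ s.count (some w) a

open Classical in
/-- The trusted task `wᵏ` (`none` for `Null`) in an iteration `k > A`; `draw` holds the uniform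
draws of this iteration. -/
def State.select (s : State A W) (τ : TieBreak A W) (α ε : ℝ) (k : ℕ) (draw : Cand W → Fin W) :
    Option (Fin W) :=
  if hI : (s.passing τ α ε k).Nonempty then
    match s.prevTask with
    | none => some (draw ⟨s.passing τ α ε k, hI⟩)
    | some v =>
      if v ∈ s.passing τ α ε k then some v
      else if hJ : (s.inheriting τ α ε k).Nonempty then
        some (τ.inherit k ⟨s.inheriting τ α ε k, hJ⟩)
      else some (draw ⟨s.passing τ α ε k, hI⟩)
  else none

/-- The choices made in one iteration: the arm pulled in each task and the trusted task. -/
structure Decision (A W : ℕ) where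
  arm : Option (Fin W) → Fin A
  trusted : Option (Fin W)

/-- The choices in iteration `k`. In the first `A` iterations the arms are pulled in turn.
Afterwards every source task follows its upper confidence bounds, and the high-tier task follows
the lower confidence bounds of the trusted task, or its own upper confidence bounds if there is
no trusted task. -/
def State.decide (s : State A W) (τ : TieBreak A W) (α ε : ℝ) (k : ℕ) (x : Noise A W) :
    Decision A W :=
  if h : k - 1 < A then ⟨fun _ => ⟨k - 1, h⟩, none⟩
  else
    { trusted := s.select τ α ε k x.2
      arm := fun m =>
        match m with
        | some w => s.upperArm τ α k (some w)
        | none =>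
          match s.select τ α ε k x.2 with
          | none => s.upperArm τ α k none
          | some w => s.lowerArm τ α k w }

/-- Iteration `k`: choose, interact with all the tasks, update. -/
def State.step (s : State A W) (τ : TieBreak A W) (α ε : ℝ) (k : ℕ) (x : Noise A W) :
    State A W where
  count := fun m i => s.count m i + if (s.decide τ α ε k x).arm m = i then 1 else 0
  total := fun m i => s.total m i + if (s.decide τ α ε k x).arm m = i then x.1 m i else 0
  prevTask := (s.decide τ α ε k x).trusted
  prevArm := some ((s.decide τ α ε k x).arm none)

/-- The memory after the iterations `1, …, n`. -/
def stateAfter (τ : TieBreak A W) (α ε : ℝ) (ω : ℕ → Noise A W) : ℕ → State A W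
  | 0 => State.initial
  | n + 1 => (stateAfter τ α ε ω n).step τ α ε (n + 1) (ω (n + 1))

/-- The high-tier arm pulled in iteration `k ≥ 1`. -/
def armHi (τ : TieBreak A W) (α ε : ℝ) (k : ℕ) (ω : ℕ → Noise A W) : Fin A :=
  ((stateAfter τ α ε ω (k - 1)).decide τ α ε k (ω k)).arm none

end TieredBandit

end

/-!
Suppose the confidence intervals of all tasks are correct in the iterations `k / 8, …, k - 1`. A
suboptimal arm of a source task then has upper confidence bound below that of the optimal arm once
it has been pulled `O(α log f(k) / Δ_min²)` times, so for `k ≥ k*` every source task has, from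
iteration `k / 2` on, spent more than half of its pulls on its optimal arm, and this is the arm
that maximizes its lower confidence bounds. The close task passes the check in all of these
iterations, so some source task is always trusted. By optimal value dominance a source task with a
wrong optimal arm can only pass while that arm has been pulled `O(α log f(k) / Δ_min²)` times in
the high-tier task. As the trusted task dictates the high-tier arm, wrong tasks are used up before
iteration `k`, and a task with the right arm is trusted at some point. From then on the inheritance
rule only ever moves to tasks with the same arm.

The number of pulls is random and depends on the rewards, so the confidence intervals are controlled
by the supermartingales `exp (t (S - μ N) - t² N / 8)` given by Hoeffding's lemma, for each fixed
value of `N` and each of two values of `t`; a union bound over iterations, tasks, arms and `N` gives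
the failure probability.
-/

noncomputable section

namespace TieredBandit

variable {A W : ℕ}

/-! ### Counting -/

section Counting

variable {ι : Type*}

theorem natCount_le_add {p : ℕ → Prop} [DecidablePred p] {U : ℝ} (hU : 0 ≤ U) {a b : ℕ}
    (hab : a ≤ b) (h : ∀ n, a ≤ n → n < b → p n → (Nat.count p n : ℝ) ≤ U) :
    (Nat.count p b : ℝ) ≤ Nat.count p a + (U + 1) := by
  induction b, hab using Nat.le_induction with
  | base => linarith
  | succ b hab ih =>
    rw [Nat.count_succ]
    split_ifs with hp
    · have hb := h b hab b.lt_succ_self hp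
      have : (0 : ℝ) ≤ Nat.count p a := Nat.cast_nonneg _
      push_cast
      linarith
    · simpa using ih fun n han hnb => h n han (hnb.trans b.lt_succ_self)

theorem sum_natCount_eq [Fintype ι] [DecidableEq ι] (x : ℕ → ι) (n : ℕ) :
    ∑ i, Nat.count (x · = i) n = n := by
  induction n with
  | zero => simp
  | succ n ih => simp [Nat.count_succ, Finset.sum_add_distrib, ih]

theorem le_natCount_of_others [Fintype ι] [DecidableEq ι] {x : ℕ → ι} {i : ι} {U : ℝ}
    (hU : 0 ≤ U) {a b : ℕ} (hab : a ≤ b)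
    (h : ∀ n, a ≤ n → n < b → x n ≠ i → (Nat.count (x · = x n) n : ℝ) ≤ U) :
    (b : ℝ) - a - Fintype.card ι * (U + 1) + Nat.count (x · = i) a ≤ Nat.count (x · = i) b := by
  have hb : ∑ j, (Nat.count (x · = j) b : ℝ) = b := mod_cast sum_natCount_eq x b
  have ha : ∑ j, (Nat.count (x · = j) a : ℝ) = a := mod_cast sum_natCount_eq x a
  rw [← Finset.add_sum_erase _ _ (Finset.mem_univ i)] at hb ha
  have others : ∑ j ∈ Finset.univ.erase i, (Nat.count (x · = j) b : ℝ) ≤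
      ∑ j ∈ Finset.univ.erase i, ((Nat.count (x · = j) a : ℝ) + (U + 1)) := by
    refine Finset.sum_le_sum fun j hj => natCount_le_add hU hab fun n han hnb hn => ?_
    simpa only [hn] using h n han hnb (hn.trans_ne (Finset.ne_of_mem_erase hj))
  rw [Finset.sum_add_distrib, Finset.sum_const, nsmul_eq_mul] at others
  have hcard : ((Finset.univ.erase i).card : ℝ) ≤ Fintype.card ι :=
    mod_cast Finset.card_le_univ _
  have := mul_le_mul_of_nonneg_right hcard (by linarith : 0 ≤ U + 1)
  linarith

theorem eq_of_half_sum_lt [Fintype ι] {c : ι → ℕ} {i j : ι}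
    (hi : ((∑ l, c l : ℕ) : ℝ) / 2 < c i) (hij : c i ≤ c j) : j = i := by
  by_contra hne
  have hpair : c j + c i ≤ ∑ l, c l := by
    classical
    rw [← Finset.sum_pair hne]
    exact Finset.sum_le_sum_of_subset (Finset.subset_univ _)
  have hpair' : (c j + c i : ℝ) ≤ (∑ l, c l : ℕ) := mod_cast hpair
  have hij' : (c i : ℝ) ≤ c j := mod_cast hij
  linarith

end Counting

/-! ### Means, optimal arms and gaps -/

theorem Bandit.mean_mem_Icc (B : Bandit A) (i : Fin A) : B.mean i ∈ Set.Icc (0 : ℝ) 1 := by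
  have hintegrable : Integrable (fun x : ℝ => x) (B.law i) :=
    Integrable.of_mem_Icc 0 1 aemeasurable_id (B.bounded i)
  constructor
  · exact integral_nonneg_of_ae ((B.bounded i).mono fun x hx => hx.1)
  · simpa [Bandit.mean] using
      integral_mono_ae hintegrable (integrable_const (1 : ℝ)) ((B.bounded i).mono fun x hx => hx.2)

theorem Bandit.mean_le_optValue (B : Bandit A) (i : Fin A) : B.mean i ≤ B.optValue :=
  le_ciSup (Set.finite_range B.mean).bddAbove i

theorem Bandit.IsOptimalArm.optValue_eq {B : Bandit A} {i : Fin A} (h : B.IsOptimalArm i) :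
    B.optValue = B.mean i :=
  have : Nonempty (Fin A) := ⟨i⟩
  le_antisymm (ciSup_le h) (B.mean_le_optValue i)

namespace Problem

variable {M : Problem A W}

theorem minGap_le_gap {m : Option (Fin W)} {i : Fin A} (h : ¬ (M.task m).IsOptimalArm i) :
    M.minGap ≤ (M.task m).gap i := by
  refine csInf_le ⟨0, ?_⟩ ⟨m, i, h, rfl⟩
  rintro d ⟨m, i, -, rfl⟩
  exact sub_nonneg.2 ((M.task m).mean_le_optValue i)

theorem exists_not_isOptimalArm (h : 0 < M.minGap) : ∃ m i, ¬ (M.task m).IsOptimalArm i := by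
  by_contra! hall
  have : {d : ℝ | ∃ m : Option (Fin W), ∃ i : Fin A,
      ¬ (M.task m).IsOptimalArm i ∧ d = (M.task m).gap i} = ∅ := by
    ext d
    simp [hall]
  rw [minGap, this, Real.sInf_empty] at h
  exact h.false

theorem minGap_le_one (h : 0 < M.minGap) : M.minGap ≤ 1 := by
  obtain ⟨m, i, hi⟩ := exists_not_isOptimalArm h
  have : Nonempty (Fin A) := ⟨i⟩
  have hopt : (M.task m).optValue ≤ 1 := ciSup_le fun j => ((M.task m).mean_mem_Icc j).2
  have hmean := ((M.task m).mean_mem_Icc i).1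
  have hgap := minGap_le_gap hi
  unfold Bandit.gap at hgap
  linarith

theorem two_le_arms (h : 0 < M.minGap) : 2 ≤ A := by
  obtain ⟨m, i, hi⟩ := exists_not_isOptimalArm h
  rw [Bandit.IsOptimalArm, not_forall] at hi
  obtain ⟨j, hj⟩ := hi
  have : i ≠ j := fun hij => hj (hij ▸ le_rfl)
  omega

/-- In every task `m` the arm `opt m` is better by at least `Δ > 0` than each of the others. -/
structure Separated (M : Problem A W) (opt : Option (Fin W) → Fin A) (Δ : ℝ) : Prop where
  gap_pos : 0 < Δ
  mean_le : ∀ m i, i ≠ opt m → (M.task m).mean i ≤ (M.task m).mean (opt m) - Δ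

/-- The assumptions under which trusting source tasks helps the high-tier task, in terms of the
optimal arms `opt m`, a lower bound `Δ` for the gaps and the tolerance `ε` of the algorithm. -/
structure IsTransferable (M : Problem A W) (opt : Option (Fin W) → Fin A) (Δ ε : ℝ) : Prop
    extends M.Separated opt Δ where
  eps_le : ε ≤ Δ / 4
  dominance : ∀ w, (M.task none).mean (opt none) - Δ / 2 ≤ (M.task (some w)).mean (opt (some w))
  exists_close : ∃ w, opt (some w) = opt none ∧
    (M.task (some w)).mean (opt none) ≤ (M.task none).mean (opt none) + ε

theorem exists_isTransferable {ε : ℝ} (huniq : M.UniqueOptimalArms)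
    (hdom : M.OptimalValueDominance) (hgap : 0 < M.minGap) (hε : ε ≤ M.minGap / 4)
    (hclose : ∃ w, M.IsClose ε w) :
    ∃ opt : Option (Fin W) → Fin A,
      (∀ m i, (M.task m).IsOptimalArm i ↔ i = opt m) ∧ M.IsTransferable opt M.minGap ε := by
  choose opt hopt hunique using huniq
  have hiff : ∀ m i, (M.task m).IsOptimalArm i ↔ i = opt m := fun m i =>
    ⟨hunique m i, fun hi => hi ▸ hopt m⟩
  have hval : ∀ m, (M.task m).optValue = (M.task m).mean (opt m) := fun m => (hopt m).optValue_eq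
  refine ⟨opt, hiff, ⟨hgap, fun m i hi => ?_⟩, hε, fun w => ?_, ?_⟩
  · have := minGap_le_gap (mt (hiff m i).1 hi)
    rw [Bandit.gap, hval] at this
    linarith
  · rw [← hval none, ← hval (some w)]
    exact hdom w
  · obtain ⟨w, hle, hsame⟩ := hclose
    have hw : opt none = opt (some w) := (hiff (some w) _).1 ((hsame _).1 (hopt none))
    refine ⟨w, hw.symm, ?_⟩
    have hle' : (M.task (some w)).optValue - (M.task none).optValue ≤ ε := hle
    rw [hval, hval, ← hw] at hle'
    linarith

end Problem

/-! ### Confidence bounds -/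

theorem one_le_confLevel (A W k : ℕ) : 1 ≤ confLevel A W k :=
  le_add_of_nonneg_right (by positivity)

theorem confLevel_mono (A W : ℕ) {k l : ℕ} (h : k ≤ l) : confLevel A W k ≤ confLevel A W l := by
  unfold confLevel
  gcongr

theorem log_confLevel_nonneg (A W k : ℕ) : 0 ≤ Real.log (confLevel A W k) :=
  Real.log_nonneg (one_le_confLevel A W k)

/-- The number of pulls after which the confidence width of an arm is at most `d`. -/
def pullBound (A W : ℕ) (α d : ℝ) (k : ℕ) : ℝ :=
  2 * α * Real.log (confLevel A W k) / d ^ 2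

theorem pullBound_nonneg {α : ℝ} (hα : 0 ≤ α) (d : ℝ) (k : ℕ) : 0 ≤ pullBound A W α d k :=
  div_nonneg (mul_nonneg (by positivity) (log_confLevel_nonneg A W k)) (sq_nonneg d)

theorem pullBound_mono {α : ℝ} (hα : 0 ≤ α) (d : ℝ) {k l : ℕ} (h : k ≤ l) :
    pullBound A W α d k ≤ pullBound A W α d l := by
  have hlog : Real.log (confLevel A W k) ≤ Real.log (confLevel A W l) :=
    Real.log_le_log (zero_lt_one.trans_le (one_le_confLevel A W k)) (confLevel_mono A W h)
  unfold pullBound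
  gcongr

namespace State

variable {s : State A W} {M : Problem A W} {α : ℝ} {k : ℕ}

theorem width_le_iff {d : ℝ} (hd : 0 < d) {m : Option (Fin W)} {i : Fin A}
    (hs : 0 < s.count m i) : s.width α k m i ≤ d ↔ pullBound A W α d k ≤ s.count m i := by
  have hN : (0 : ℝ) < s.count m i := Nat.cast_pos.2 hs
  rw [width, Real.sqrt_le_left hd.le, pullBound, div_le_comm₀ hN (by positivity)]

theorem le_width_iff {d : ℝ} (hd : 0 < d) {m : Option (Fin W)} {i : Fin A}
    (hs : 0 < s.count m i) : d ≤ s.width α k m i ↔ s.count m i ≤ pullBound A W α d k := by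
  have hN : (0 : ℝ) < s.count m i := Nat.cast_pos.2 hs
  rw [width, Real.le_sqrt' hd, pullBound, le_div_comm₀ (by positivity) hN]

/-- All empirical means are within the confidence width of the true means. -/
def Accurate (s : State A W) (M : Problem A W) (α : ℝ) (k : ℕ) : Prop :=
  ∀ m i, |s.empMean m i - (M.task m).mean i| ≤ s.width α k m i

theorem Accurate.mean_le_ucb (h : s.Accurate M α k) (m : Option (Fin W)) (i : Fin A) :
    (M.task m).mean i ≤ s.ucb α k m i := by
  have := (abs_le.1 (h m i)).1
  unfold ucb
  linarith

theorem Accurate.ucb_le (h : s.Accurate M α k) (m : Option (Fin W)) (i : Fin A) :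
    s.ucb α k m i ≤ (M.task m).mean i + 2 * s.width α k m i := by
  have := (abs_le.1 (h m i)).2
  unfold ucb
  linarith

theorem Accurate.lcb_le_mean (h : s.Accurate M α k) (m : Option (Fin W)) (i : Fin A) :
    s.lcb α k m i ≤ (M.task m).mean i := by
  have := (abs_le.1 (h m i)).2
  unfold lcb
  linarith

theorem Accurate.le_lcb (h : s.Accurate M α k) (m : Option (Fin W)) (i : Fin A) :
    (M.task m).mean i - 2 * s.width α k m i ≤ s.lcb α k m i := by
  have := (abs_le.1 (h m i)).1
  unfold lcb
  linarith

/-! ### Choices made from accurate estimates -/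

variable {τ : TieBreak A W} {opt : Option (Fin W) → Fin A} {Δ ε : ℝ}

theorem Accurate.count_upperArm_le (h : s.Accurate M α k) (hM : M.Separated opt Δ)
    {m : Option (Fin W)} (hpos : ∀ i, 0 < s.count m i) (hne : s.upperArm τ α k m ≠ opt m) :
    s.count m (s.upperArm τ α k m) ≤ pullBound A W α (Δ / 16) k := by
  have hΔ := hM.gap_pos
  refine (le_width_iff (by positivity) (hpos _)).1 ?_
  have hopt := h.mean_le_ucb m (opt m)
  have hmax : s.ucb α k m (opt m) ≤ s.ucb α k m (s.upperArm τ α k m) := τ.upper_max k m _ _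
  have hupper := h.ucb_le m (s.upperArm τ α k m)
  have hgap := hM.mean_le m _ hne
  linarith

/-- After `k - 1` iterations, every source task has given more than half of its pulls to its
optimal arm and estimates the mean of this arm up to a fraction of the gap `Δ`. -/
structure Settled (s : State A W) (opt : Option (Fin W) → Fin A) (α Δ : ℝ) (k : ℕ) : Prop where
  sum_count_le : ∀ w, ∑ i, s.count (some w) i ≤ k
  half_lt : ∀ w, (k : ℝ) / 2 < s.count (some w) (opt (some w))
  width_le : ∀ w, s.width α k (some w) (opt (some w)) ≤ Δ / 16

theorem Accurate.lowerArm_eq (h : s.Accurate M α k) (hM : M.Separated opt Δ)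
    (hs : s.Settled opt α Δ k) (w : Fin W) : s.lowerArm τ α k w = opt (some w) := by
  by_contra hne
  have hΔ := hM.gap_pos
  have hopt := h.le_lcb (some w) (opt (some w))
  have hmax : s.lcb α k (some w) (opt (some w)) ≤ s.lcb α k (some w) (s.lowerArm τ α k w) :=
    τ.lower_max k w _ _
  have hlower := h.lcb_le_mean (some w) (s.lowerArm τ α k w)
  have hgap := hM.mean_le (some w) _ hne
  have hwidth := hs.width_le w
  linarith

theorem Settled.eq_opt_of_forall_count_le (hs : s.Settled opt α Δ k) {w : Fin W} {i : Fin A}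
    (hi : ∀ j, s.count (some w) j ≤ s.count (some w) i) : i = opt (some w) := by
  refine eq_of_half_sum_lt (lt_of_le_of_lt ?_ (hs.half_lt w)) (hi _)
  gcongr
  exact hs.sum_count_le w

theorem Settled.count_le (hs : s.Settled opt α Δ k) (w : Fin W) (j : Fin A) :
    s.count (some w) j ≤ s.count (some w) (opt (some w)) := by
  have : Nonempty (Fin A) := ⟨j⟩
  obtain ⟨i, hi⟩ := Finite.exists_max (s.count (some w))
  exact hs.eq_opt_of_forall_count_le hi ▸ hi j

theorem mem_passing {w : Fin W} : w ∈ s.passing τ α ε k ↔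
    s.lcb α k (some w) (s.lowerArm τ α k w) ≤ s.ucb α k none (s.lowerArm τ α k w) + ε ∧
      (k : ℝ) / 2 < s.count (some w) (s.lowerArm τ α k w) := by
  simp [passing]

theorem mem_inheriting {w : Fin W} : w ∈ s.inheriting τ α ε k ↔ w ∈ s.passing τ α ε k ∧
    ∃ a, s.prevArm = some a ∧ ∀ j, s.count (some w) j ≤ s.count (some w) a := by
  simp [inheriting]

theorem Accurate.exists_mem_passing (h : s.Accurate M α k) (hM : M.IsTransferable opt Δ ε)
    (hs : s.Settled opt α Δ k) : ∃ w ∈ s.passing τ α ε k, opt (some w) = opt none := by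
  obtain ⟨w, hw, hclose⟩ := hM.exists_close
  refine ⟨w, mem_passing.2 ?_, hw⟩
  rw [h.lowerArm_eq hM.toSeparated hs]
  refine ⟨?_, hs.half_lt w⟩
  have hlcb := h.lcb_le_mean (some w) (opt none)
  have hucb := h.mean_le_ucb none (opt none)
  rw [hw]
  linarith

/-- By optimal value dominance, a source task with the wrong optimal arm fails the check as soon
as the high-tier task knows the mean of this arm well enough. -/
theorem Accurate.count_le_of_mem_passing (h : s.Accurate M α k) (hM : M.IsTransferable opt Δ ε)
    (hs : s.Settled opt α Δ k) (hpos : ∀ i, 0 < s.count none i) {w : Fin W}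
    (hne : opt (some w) ≠ opt none) (hw : w ∈ s.passing τ α ε k) :
    s.count none (opt (some w)) ≤ pullBound A W α (Δ / 16) k := by
  have hΔ := hM.gap_pos
  refine (le_width_iff (by positivity) (hpos _)).1 ?_
  have hcheck := (mem_passing.1 hw).1
  rw [h.lowerArm_eq hM.toSeparated hs] at hcheck
  have hlcb := h.le_lcb (some w) (opt (some w))
  have hucb := h.ucb_le none (opt (some w))
  have hgap := hM.mean_le none _ hne
  have hdom := hM.dominance w
  have hwidth := hs.width_le w
  have hε := hM.eps_le
  linarith

theorem exists_select_eq_some {draw : Cand W → Fin W} (hne : (s.passing τ α ε k).Nonempty) :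
    ∃ w, s.select τ α ε k draw = some w := by
  rw [select, dif_pos hne]
  split
  · exact ⟨_, rfl⟩
  · split_ifs <;> exact ⟨_, rfl⟩

theorem mem_passing_of_select {draw : Cand W → Fin W} (hdraw : ∀ S, draw S ∈ S.1) {w : Fin W}
    (h : s.select τ α ε k draw = some w) : w ∈ s.passing τ α ε k := by
  have hinherit : ∀ S : Cand W, S.1 ⊆ s.passing τ α ε k → τ.inherit k S ∈ s.passing τ α ε k :=
    fun S hS => hS (τ.inherit_mem k S)
  by_cases hI : (s.passing τ α ε k).Nonempty
  case neg => simp [select, hI] at h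
  rw [select, dif_pos hI] at h
  split at h
  · exact Option.some.inj h ▸ hdraw ⟨_, hI⟩
  · split_ifs at h with hv hJ
    · exact Option.some.inj h ▸ hv
    · exact Option.some.inj h ▸ hinherit ⟨_, hJ⟩ fun v hv => (mem_inheriting.1 hv).1
    · exact Option.some.inj h ▸ hdraw ⟨_, hI⟩

/-- The inheritance rule makes trust in a source task with the right arm absorbing: if the trusted
task ceases to pass the check, then the task that takes over has the same most pulled arm. -/
theorem Accurate.exists_select_of_prevArm (h : s.Accurate M α k) (hM : M.IsTransferable opt Δ ε)
    (hs : s.Settled opt α Δ k) {v : Fin W} (hv : opt (some v) = opt none)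
    (htask : s.prevTask = some v) (harm : s.prevArm = some (opt none)) (draw : Cand W → Fin W) :
    ∃ u, s.select τ α ε k draw = some u ∧ opt (some u) = opt none := by
  obtain ⟨w, hw, hwopt⟩ := h.exists_mem_passing (τ := τ) hM hs
  have hJ : (s.inheriting τ α ε k).Nonempty :=
    ⟨w, mem_inheriting.2 ⟨hw, opt none, harm, hwopt ▸ hs.count_le w⟩⟩
  rw [select, dif_pos ⟨w, hw⟩]
  simp only [htask]
  split_ifs
  · exact ⟨v, rfl, hv⟩
  · refine ⟨_, rfl, ?_⟩
    obtain ⟨-, i, hi, hmax⟩ := mem_inheriting.1 (τ.inherit_mem k ⟨_, hJ⟩)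
    rw [harm, Option.some.injEq] at hi
    exact (hi ▸ hs.eq_opt_of_forall_count_le hmax).symm

theorem decide_arm_of_lt {n : ℕ} (h : n < A) (x : Noise A W) (m : Option (Fin W)) :
    (s.decide τ α ε (n + 1) x).arm m = ⟨n, h⟩ := by
  simp [decide, h]

theorem decide_arm_some {n : ℕ} (h : A ≤ n) (x : Noise A W) (w : Fin W) :
    (s.decide τ α ε (n + 1) x).arm (some w) = s.upperArm τ α (n + 1) (some w) := by
  simp [decide, not_lt.2 h]

theorem decide_arm_none {n : ℕ} (h : A ≤ n) {x : Noise A W} {w : Fin W}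
    (hw : s.select τ α ε (n + 1) x.2 = some w) :
    (s.decide τ α ε (n + 1) x).arm none = s.lowerArm τ α (n + 1) w := by
  simp [decide, not_lt.2 h, hw]

theorem decide_trusted {n : ℕ} (h : A ≤ n) (x : Noise A W) :
    (s.decide τ α ε (n + 1) x).trusted = s.select τ α ε (n + 1) x.2 := by
  simp [decide, not_lt.2 h]

end State

/-! ### Runs with accurate estimates -/

section Run

variable (τ : TieBreak A W) (α ε : ℝ) (ω : ℕ → Noise A W)

/-- The arm that iteration `n + 1` pulls in task `m`. Iterations are numbered from `1`, so this is
the choice made from the memory after `n` iterations. -/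
def pulledArm (n : ℕ) (m : Option (Fin W)) : Fin A :=
  ((stateAfter τ α ε ω n).decide τ α ε (n + 1) (ω (n + 1))).arm m

theorem count_stateAfter (n : ℕ) (m : Option (Fin W)) (i : Fin A) :
    (stateAfter τ α ε ω n).count m i = Nat.count (pulledArm τ α ε ω · m = i) n := by
  induction n with
  | zero => rfl
  | succ n ih => rw [Nat.count_succ, ← ih]; rfl

theorem sum_count_stateAfter (n : ℕ) (m : Option (Fin W)) :
    ∑ i, (stateAfter τ α ε ω n).count m i = n := by
  simp only [count_stateAfter, sum_natCount_eq (pulledArm τ α ε ω · m)]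

theorem count_stateAfter_pos {n : ℕ} (hn : A ≤ n) (m : Option (Fin W)) (i : Fin A) :
    0 < (stateAfter τ α ε ω n).count m i := by
  have hi : pulledArm τ α ε ω i m = i := State.decide_arm_of_lt i.2 _ _
  rw [count_stateAfter]
  refine lt_of_lt_of_le ?_ (Nat.count_monotone _ (Nat.succ_le_of_lt (i.2.trans_le hn)))
  rw [Nat.count_succ, if_pos hi]
  exact Nat.succ_pos _

/-- A run whose estimates are accurate in the iterations `a + 1, …, N + 1`, and whose random draws
lie in the sets drawn from. The first `a` iterations include those that try the arms in turn. -/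
structure FavorableRun (M : Problem A W) (τ : TieBreak A W) (α ε : ℝ) (ω : ℕ → Noise A W)
    (a N : ℕ) : Prop where
  arms_le : A ≤ a
  draw_mem : ∀ n S, (ω n).2 S ∈ S.1
  accurate : ∀ n, a ≤ n → n ≤ N → (stateAfter τ α ε ω n).Accurate M α (n + 1)

end Run

namespace FavorableRun

variable {M : Problem A W} {τ : TieBreak A W} {α ε : ℝ} {ω : ℕ → Noise A W}
  {opt : Option (Fin W) → Fin A} {Δ : ℝ} {a b n N : ℕ}

theorem le_count_some (h : FavorableRun M τ α ε ω a N) (hM : M.Separated opt Δ) (hα : 0 ≤ α)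
    (hn : a ≤ n) (hN : n ≤ N) (w : Fin W) :
    (n : ℝ) - a - A * (pullBound A W α (Δ / 16) (N + 1) + 1) ≤
      (stateAfter τ α ε ω n).count (some w) (opt (some w)) := by
  have hcount := le_natCount_of_others (x := (pulledArm τ α ε ω · (some w)))
    (i := opt (some w)) (pullBound_nonneg (A := A) (W := W) hα (Δ / 16) (N + 1)) hn
    fun l hal hln hne => ?_
  · rw [Fintype.card_fin, ← count_stateAfter, ← count_stateAfter] at hcount
    have : (0 : ℝ) ≤ (stateAfter τ α ε ω a).count (some w) (opt (some w)) := Nat.cast_nonneg _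
    linarith
  · have hAl : A ≤ l := h.arms_le.trans hal
    have harm : pulledArm τ α ε ω l (some w) =
        (stateAfter τ α ε ω l).upperArm τ α (l + 1) (some w) := State.decide_arm_some hAl _ w
    rw [← count_stateAfter, harm]
    rw [harm] at hne
    exact ((h.accurate l hal (by omega)).count_upperArm_le hM
      (count_stateAfter_pos τ α ε ω hAl _) hne).trans (pullBound_mono hα _ (by omega))

theorem settled (h : FavorableRun M τ α ε ω a N) (hM : M.Separated opt Δ) (hα : 0 ≤ α)
    (hA : 2 ≤ A)
    (hlate : 2 * (a + A * (pullBound A W α (Δ / 16) (N + 1) + 1)) + 1 < n) (hN : n ≤ N) :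
    (stateAfter τ α ε ω n).Settled opt α Δ (n + 1) := by
  have hΔ := hM.gap_pos
  have hA' : (2 : ℝ) ≤ A := mod_cast hA
  have hU : 0 ≤ pullBound A W α (Δ / 16) (N + 1) := pullBound_nonneg hα _ _
  have : (0 : ℝ) ≤ a := a.cast_nonneg
  have han : a ≤ n := by
    have : (a : ℝ) ≤ n := by nlinarith
    exact_mod_cast this
  have hcount := h.le_count_some hM hα han hN
  refine ⟨fun w => (sum_count_stateAfter τ α ε ω n (some w)).trans_le n.le_succ, fun w => ?_,
    fun w => ?_⟩
  · have := hcount w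
    push_cast
    linarith
  · refine (State.width_le_iff (by positivity)
      (count_stateAfter_pos τ α ε ω (h.arms_le.trans han) _ _)).2 ?_
    refine (pullBound_mono hα _ (by omega : n + 1 ≤ N + 1)).trans ?_
    have := hcount w
    nlinarith

theorem exists_select_eq_some (h : FavorableRun M τ α ε ω a N) (hM : M.IsTransferable opt Δ ε)
    (hn : a ≤ n) (hN : n ≤ N) (hs : (stateAfter τ α ε ω n).Settled opt α Δ (n + 1)) :
    ∃ w, (stateAfter τ α ε ω n).select τ α ε (n + 1) (ω (n + 1)).2 = some w ∧
      pulledArm τ α ε ω n none = opt (some w) := by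
  obtain ⟨v, hv, -⟩ := (h.accurate n hn hN).exists_mem_passing (τ := τ) hM hs
  obtain ⟨w, hw⟩ := State.exists_select_eq_some (draw := (ω (n + 1)).2) ⟨v, hv⟩
  exact ⟨w, hw, (State.decide_arm_none (h.arms_le.trans hn) hw).trans
    ((h.accurate n hn hN).lowerArm_eq hM.toSeparated hs w)⟩

theorem pulledArm_succ (h : FavorableRun M τ α ε ω a N) (hM : M.IsTransferable opt Δ ε)
    (hn : a ≤ n) (hN : n + 1 ≤ N) (hs : (stateAfter τ α ε ω n).Settled opt α Δ (n + 1))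
    (hs' : (stateAfter τ α ε ω (n + 1)).Settled opt α Δ (n + 1 + 1))
    (hopt : pulledArm τ α ε ω n none = opt none) :
    pulledArm τ α ε ω (n + 1) none = opt none := by
  have hn' : a ≤ n + 1 := by omega
  have hacc := h.accurate (n + 1) hn' hN
  obtain ⟨v, hsel, harm⟩ := h.exists_select_eq_some hM hn (by omega) hs
  have htask : (stateAfter τ α ε ω (n + 1)).prevTask = some v :=
    (State.decide_trusted (h.arms_le.trans hn) _).trans hsel
  obtain ⟨u, hu, huopt⟩ := hacc.exists_select_of_prevArm hM hs' (harm.symm.trans hopt) htask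
    (congrArg some hopt) (ω (n + 1 + 1)).2
  rw [pulledArm, State.decide_arm_none (h.arms_le.trans hn') hu,
    hacc.lowerArm_eq hM.toSeparated hs', huopt]

theorem exists_pulledArm_eq (h : FavorableRun M τ α ε ω a N) (hM : M.IsTransferable opt Δ ε)
    (hα : 0 ≤ α) (hab : a ≤ b)
    (hs : ∀ n, b ≤ n → n ≤ N → (stateAfter τ α ε ω n).Settled opt α Δ (n + 1))
    (hlarge : b + A * (pullBound A W α (Δ / 16) (N + 1) + 1) < N) :
    ∃ n, b ≤ n ∧ n < N ∧ pulledArm τ α ε ω n none = opt none := by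
  by_contra! hnever
  have hU : 0 ≤ pullBound A W α (Δ / 16) (N + 1) := pullBound_nonneg hα _ _
  have hbN : b ≤ N := by
    have : (b : ℝ) ≤ N := by nlinarith [A.cast_nonneg (α := ℝ)]
    exact_mod_cast this
  have hcount := le_natCount_of_others (x := (pulledArm τ α ε ω · none)) (i := opt none) hU hbN
    fun n hbn hnN hne => ?_
  · have hconst : Nat.count (pulledArm τ α ε ω · none = opt none) N =
        Nat.count (pulledArm τ α ε ω · none = opt none) b := by
      rw [← Nat.add_sub_cancel' hbN, Nat.count_add, Nat.add_eq_left,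
        Nat.count_iff_forall_not]
      exact fun l hl => hnever (b + l) (by omega) (by omega)
    rw [hconst, Fintype.card_fin] at hcount
    linarith
  · have han : a ≤ n := hab.trans hbn
    obtain ⟨w, hsel, harm⟩ := h.exists_select_eq_some hM han hnN.le (hs n hbn hnN.le)
    rw [← count_stateAfter, harm]
    rw [harm] at hne
    exact ((h.accurate n han hnN.le).count_le_of_mem_passing hM (hs n hbn hnN.le)
      (count_stateAfter_pos τ α ε ω (h.arms_le.trans han) _) hne
      (State.mem_passing_of_select (h.draw_mem (n + 1)) hsel)).trans
      (pullBound_mono hα _ (by omega))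

theorem pulledArm_eq (h : FavorableRun M τ α ε ω a N) (hM : M.IsTransferable opt Δ ε)
    (hα : 0 ≤ α) (hab : a ≤ b)
    (hs : ∀ n, b ≤ n → n ≤ N → (stateAfter τ α ε ω n).Settled opt α Δ (n + 1))
    (hlarge : b + A * (pullBound A W α (Δ / 16) (N + 1) + 1) < N) :
    pulledArm τ α ε ω N none = opt none := by
  obtain ⟨n, hbn, hnN, hn⟩ := h.exists_pulledArm_eq hM hα hab hs hlarge
  suffices ∀ l, n ≤ l → l ≤ N → pulledArm τ α ε ω l none = opt none from this N hnN.le le_rfl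
  intro l hl
  induction l, hl using Nat.le_induction with
  | base => exact fun _ => hn
  | succ l hl ih =>
    exact fun hlN => h.pulledArm_succ hM (hab.trans (hbn.trans hl)) hlN
      (hs l (hbn.trans hl) (by omega)) (hs (l + 1) (by omega) hlN) (ih (by omega))

/-- Accuracy from iteration `k / 8` on settles the source tasks by iteration `k / 2`, and leaves
enough time for a source task with the right arm to become trusted before iteration `k`. -/
theorem armHi_eq {k : ℕ} (h : FavorableRun M τ α ε ω (k / 8) (k - 1))
    (hM : M.IsTransferable opt Δ ε) (hα : 0 ≤ α) (hA : 2 ≤ A)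
    (hk : 16 * (A * (pullBound A W α (Δ / 16) k + 1)) ≤ k) : armHi τ α ε k ω = opt none := by
  have hA' : (2 : ℝ) ≤ A := mod_cast hA
  have hU : 0 ≤ pullBound A W α (Δ / 16) k := pullBound_nonneg hα _ _
  have hk32 : 32 ≤ k := by
    have : (32 : ℝ) ≤ k := by nlinarith
    exact_mod_cast this
  obtain ⟨N, rfl⟩ : ∃ N, k = N + 1 := ⟨k - 1, by omega⟩
  have hdiv8 : (((N + 1) / 8 : ℕ) : ℝ) ≤ ((N : ℝ) + 1) / 8 := mod_cast Nat.cast_div_le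
  have hdiv2 : (((N + 1) / 2 : ℕ) : ℝ) ≤ ((N : ℝ) + 1) / 2 := mod_cast Nat.cast_div_le
  push_cast at hk
  have hN : (31 : ℝ) ≤ N := mod_cast (by omega : 31 ≤ N)
  refine h.pulledArm_eq hM hα (by omega : (N + 1) / 8 ≤ (N + 1) / 2) (fun n hbn hnN => ?_) ?_
  · refine h.settled hM.toSeparated hα hA ?_ hnN
    have hn : ((N : ℝ) + 1) / 2 ≤ n + 1 / 2 := by
      have : ((N : ℝ) + 1) ≤ 2 * n + 1 := mod_cast (by omega : N + 1 ≤ 2 * n + 1)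
      linarith
    simp only [Nat.add_sub_cancel]
    linarith
  · simp only [Nat.add_sub_cancel]
    linarith

end FavorableRun

/-! ### Measurability -/

section Measurability

local instance (n : ℕ) : MeasurableSpace (Option (Fin n)) := ⊤

local instance (n : ℕ) : DiscreteMeasurableSpace (Option (Fin n)) := ⟨fun _ => trivial⟩

theorem measurable_apply_of_countable {Ω ι β : Type*} [MeasurableSpace Ω] [MeasurableSpace ι]
    [Countable ι] [MeasurableSingletonClass ι] [MeasurableSpace β] {F : Ω → ι → β} {g : Ω → ι}
    (hF : ∀ i, Measurable fun x => F x i) (hg : Measurable g) : Measurable fun x => F x (g x) :=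
  (measurable_from_prod_countable_right (f := fun p : ι × Ω => F p.2 p.1) hF).comp
    (hg.prodMk measurable_id)

instance : MeasurableSpace (State A W) :=
  MeasurableSpace.comap (fun s => (s.count, s.total, s.prevTask, s.prevArm)) inferInstance

instance : MeasurableSpace (Decision A W) := ⊤

instance : DiscreteMeasurableSpace (Decision A W) := ⟨fun _ => trivial⟩

namespace State

theorem measurable_fields :
    Measurable fun s : State A W => (s.count, s.total, s.prevTask, s.prevArm) :=
  comap_measurable _

theorem measurable_count (m : Option (Fin W)) (i : Fin A) :
    Measurable fun s : State A W => s.count m i :=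
  measurable_fields.fst.eval.eval

theorem measurable_total (m : Option (Fin W)) (i : Fin A) :
    Measurable fun s : State A W => s.total m i :=
  measurable_fields.snd.fst.eval.eval

theorem measurable_prevTask : Measurable fun s : State A W => s.prevTask :=
  measurable_fields.snd.snd.fst

theorem measurable_prevArm : Measurable fun s : State A W => s.prevArm :=
  measurable_fields.snd.snd.snd

theorem measurable_cast_count (m : Option (Fin W)) (i : Fin A) :
    Measurable fun s : State A W => (s.count m i : ℝ) :=
  (Measurable.of_discrete (f := fun n : ℕ => (n : ℝ))).comp (measurable_count m i)

theorem measurable_empMean (m : Option (Fin W)) (i : Fin A) :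
    Measurable fun s : State A W => s.empMean m i :=
  (measurable_total m i).div (measurable_cast_count m i)

theorem measurable_width (α : ℝ) (k : ℕ) (m : Option (Fin W)) (i : Fin A) :
    Measurable fun s : State A W => s.width α k m i :=
  (measurable_const.div (measurable_cast_count m i)).sqrt

theorem measurable_ucb (α : ℝ) (k : ℕ) (m : Option (Fin W)) :
    Measurable fun s : State A W => s.ucb α k m :=
  measurable_pi_lambda _ fun i => (measurable_empMean m i).add (measurable_width α k m i)

theorem measurable_lcb (α : ℝ) (k : ℕ) (m : Option (Fin W)) :
    Measurable fun s : State A W => s.lcb α k m :=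
  measurable_pi_lambda _ fun i => (measurable_empMean m i).sub (measurable_width α k m i)

variable (τ : TieBreak A W) (α ε : ℝ) (k : ℕ)

theorem measurable_upperArm (m : Option (Fin W)) :
    Measurable fun s : State A W => s.upperArm τ α k m :=
  (τ.upper_measurable k m).comp (measurable_ucb α k m)

theorem measurable_lowerArm (w : Fin W) : Measurable fun s : State A W => s.lowerArm τ α k w :=
  (τ.lower_measurable k w).comp (measurable_lcb α k (some w))

theorem measurable_passing : Measurable fun s : State A W => s.passing τ α ε k := by
  refine measurable_finset_iff.2 fun w => ?_
  simp only [mem_passing]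
  have harm := measurable_lowerArm (A := A) τ α k w
  have hlcb : Measurable fun s : State A W => s.lcb α k (some w) (s.lowerArm τ α k w) :=
    measurable_apply_of_countable (fun i => (measurable_lcb α k (some w)).eval (a := i)) harm
  have hucb : Measurable fun s : State A W => s.ucb α k none (s.lowerArm τ α k w) :=
    measurable_apply_of_countable (fun i => (measurable_ucb α k none).eval (a := i)) harm
  have hcount : Measurable fun s : State A W => (s.count (some w) (s.lowerArm τ α k w) : ℝ) :=
    measurable_apply_of_countable (F := fun s i => (s.count (some w) i : ℝ))
      (measurable_cast_count (some w)) harm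
  exact measurableSet_setOfPred.1
    ((measurableSet_le hlcb (hucb.add_const ε)).inter (measurableSet_lt measurable_const hcount))

theorem measurable_inheriting : Measurable fun s : State A W => s.inheriting τ α ε k := by
  refine measurable_finset_iff.2 fun w => ?_
  simp only [mem_inheriting]
  have hprev : ∀ a, Measurable fun s : State A W => s.prevArm = some a := fun a =>
    (Measurable.of_discrete (f := fun b : Option (Fin A) => b = some a)).comp measurable_prevArm
  have hle : ∀ j a, Measurable fun s : State A W => s.count (some w) j ≤ s.count (some w) a :=
    fun j a => measurableSet_setOfPred.1
      (measurableSet_le (measurable_count (some w) j) (measurable_count (some w) a))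
  exact (measurable_finset_iff.1 (measurable_passing τ α ε k) w).and
    (Measurable.exists fun a => (hprev a).and (Measurable.forall fun j => hle j a))

end State

/-- `State.select` as a function of the data on which it depends, which are discrete. -/
def selectFrom (τ : TieBreak A W) (k : ℕ) (I J : Finset (Fin W)) (prev : Option (Fin W))
    (draw : Cand W → Fin W) : Option (Fin W) :=
  open Classical in
  if hI : I.Nonempty then
    match prev with
    | none => some (draw ⟨I, hI⟩)
    | some v =>
      if v ∈ I then some v
      else if hJ : J.Nonempty then some (τ.inherit k ⟨J, hJ⟩)
      else some (draw ⟨I, hI⟩)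
  else none

variable (τ : TieBreak A W) (α ε : ℝ) (k : ℕ)

theorem measurable_select :
    Measurable fun p : State A W × Noise A W => p.1.select τ α ε k p.2.2 := by
  have h : Measurable fun q : Finset (Fin W) × Finset (Fin W) × Option (Fin W) ×
    (Cand W → Fin W) => selectFrom τ k q.1 q.2.1 q.2.2.1 q.2.2.2 := .of_discrete
  exact h.comp (((State.measurable_passing τ α ε k).comp measurable_fst).prodMk
    (((State.measurable_inheriting τ α ε k).comp measurable_fst).prodMk
      ((State.measurable_prevTask.comp measurable_fst).prodMk measurable_snd.snd)))

theorem measurable_decide :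
    Measurable fun p : State A W × Noise A W => p.1.decide τ α ε k p.2 := by
  unfold State.decide
  split_ifs with h
  · exact measurable_const
  have hupper : Measurable fun p : State A W × Noise A W => fun m => p.1.upperArm τ α k m :=
    measurable_pi_lambda _ fun m => (State.measurable_upperArm τ α k m).comp measurable_fst
  have hlower : Measurable fun p : State A W × Noise A W => fun w => p.1.lowerArm τ α k w :=
    measurable_pi_lambda _ fun w => (State.measurable_lowerArm τ α k w).comp measurable_fst
  exact (Measurable.of_discrete (f := fun q : Option (Fin W) ×
    ((Option (Fin W) → Fin A) × (Fin W → Fin A)) =>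
      ({ trusted := q.1
         arm := fun m =>
          match m with
          | some w => q.2.1 (some w)
          | none =>
            match q.1 with
            | none => q.2.1 none
            | some w => q.2.2 w } : Decision A W))).comp
    ((measurable_select τ α ε k).prodMk (hupper.prodMk hlower))

theorem measurable_step :
    Measurable fun p : State A W × Noise A W => p.1.step τ α ε k p.2 := by
  have hdecide := measurable_decide (A := A) (W := W) τ α ε k
  have harm (m : Option (Fin W)) (i : Fin A) :
      MeasurableSet {p : State A W × Noise A W | (p.1.decide τ α ε k p.2).arm m = i} :=
    hdecide (.of_discrete (s := {d : Decision A W | d.arm m = i}))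
  refine measurable_comap_iff.2 (.prodMk ?_ (.prodMk ?_ (.prodMk ?_ ?_)))
  · exact measurable_pi_lambda _ fun m => measurable_pi_lambda _ fun i =>
      ((State.measurable_count m i).comp measurable_fst).add
        (Measurable.ite (harm m i) measurable_const measurable_const)
  · exact measurable_pi_lambda _ fun m => measurable_pi_lambda _ fun i =>
      ((State.measurable_total m i).comp measurable_fst).add
        (Measurable.ite (harm m i) measurable_snd.fst.eval.eval measurable_const)
  · exact (Measurable.of_discrete (f := Decision.trusted)).comp hdecide
  · exact (Measurable.of_discrete (f := fun d : Decision A W => some (d.arm none))).comp hdecide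

end Measurability

/-! ### Concentration -/

section Concentration

variable (M : Problem A W) (τ : TieBreak A W) (α ε : ℝ)

theorem measurable_stateAfter_iSup (n : ℕ) :
    Measurable[⨆ l ∈ Set.Iic n, MeasurableSpace.comap (fun ω => ω l) inferInstance]
      fun ω : ℕ → Noise A W => stateAfter τ α ε ω n := by
  induction n with
  | zero => exact measurable_const
  | succ n ih =>
    refine (measurable_step τ α ε (n + 1)).comp (.prodMk (ih.mono ?_ le_rfl)
      ((comap_measurable _).mono ?_ le_rfl))
    · exact biSup_mono fun l hl => Set.Iic_subset_Iic.2 n.le_succ hl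
    · exact le_biSup (fun l => MeasurableSpace.comap (fun ω : ℕ → Noise A W => ω l) inferInstance)
        (Set.mem_Iic.2 le_rfl)

theorem measurable_stateAfter (n : ℕ) :
    Measurable fun ω : ℕ → Noise A W => stateAfter τ α ε ω n :=
  (measurable_stateAfter_iSup τ α ε n).mono
    (iSup₂_le fun l _ => (measurable_pi_apply l).comap_le) le_rfl

theorem indepFun_stateAfter (n : ℕ) :
    IndepFun (fun ω => stateAfter τ α ε ω n) (fun ω => ω (n + 1)) M.P := by
  have hindep : iIndepFun (fun (l : ℕ) (ω : ℕ → Noise A W) => ω l) M.P :=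
    iIndepFun_infinitePi (P := fun _ : ℕ => M.noiseLaw) (X := fun _ x => x)
      fun _ => measurable_id
  have hdisj : Disjoint (Set.Iic n) {n + 1} := by simp
  refine indep_of_indep_of_le_left (indep_of_indep_of_le_right
    (indep_iSup_of_disjoint (fun l => (measurable_pi_apply l).comap_le) hindep hdisj) ?_)
    (measurable_stateAfter_iSup τ α ε n).comap_le
  simp

theorem map_stateAfter_prod (n : ℕ) :
    M.P.map (fun ω => (stateAfter τ α ε ω n, ω (n + 1))) =
      (M.P.map fun ω => stateAfter τ α ε ω n).prod M.noiseLaw := by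
  rw [(indepFun_stateAfter M τ α ε n).map_prod_eq_prod_map_map
    (measurable_stateAfter τ α ε n).aemeasurable (measurable_pi_apply _).aemeasurable]
  congr 1
  exact Measure.infinitePi_map_eval (fun _ : ℕ => M.noiseLaw) (n + 1)

theorem Bandit.lintegral_exp_le_one (B : Bandit A) (i : Fin A) (t : ℝ) :
    ∫⁻ x, ENNReal.ofReal (Real.exp (t * (x - B.mean i) - t ^ 2 / 8)) ∂(B.law i) ≤ 1 := by
  have hoeffding := hasSubgaussianMGF_of_mem_Icc (X := fun x : ℝ => x) aemeasurable_id (B.bounded i)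
  have hintegrable : Integrable (fun x => Real.exp (t * (x - B.mean i))) (B.law i) :=
    hoeffding.integrable_exp_mul t
  have hmgf : ∫ x, Real.exp (t * (x - B.mean i)) ∂(B.law i) ≤ Real.exp (t ^ 2 / 8) := by
    refine (hoeffding.mgf_le t).trans_eq (congrArg Real.exp ?_)
    norm_num
    ring
  have hsplit : ∀ x : ℝ, Real.exp (t * (x - B.mean i) - t ^ 2 / 8) =
      Real.exp (-(t ^ 2 / 8)) * Real.exp (t * (x - B.mean i)) := fun x => by
    rw [← Real.exp_add]
    ring_nf
  simp_rw [hsplit]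
  rw [← ofReal_integral_eq_lintegral_ofReal (hintegrable.const_mul _)
    (.of_forall fun x => by positivity), integral_const_mul, ENNReal.ofReal_le_one]
  calc Real.exp (-(t ^ 2 / 8)) * ∫ x, Real.exp (t * (x - B.mean i)) ∂(B.law i)
      ≤ Real.exp (-(t ^ 2 / 8)) * Real.exp (t ^ 2 / 8) := by gcongr
    _ = 1 := by rw [← Real.exp_add, neg_add_cancel, Real.exp_zero]

namespace State

/-- The exponential weight `exp (t (S - μ N) - t² N / 8)` of an arm with mean `μ` whose `N` pulls
gave the total reward `S`. It is a supermartingale along the run, by Hoeffding's lemma. -/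
def expWeight (s : State A W) (M : Problem A W) (m : Option (Fin W)) (i : Fin A) (t : ℝ) :
    ENNReal :=
  ENNReal.ofReal (Real.exp (t * (s.total m i - (M.task m).mean i * s.count m i) -
    t ^ 2 / 8 * s.count m i))

theorem measurable_expWeight (m : Option (Fin W)) (i : Fin A) (t : ℝ) :
    Measurable fun s : State A W => s.expWeight M m i t := by
  have htotal := measurable_total (A := A) m i
  have hcount := measurable_cast_count (A := A) m i
  unfold expWeight
  fun_prop

theorem expWeight_step (s : State A W) (k : ℕ) (x : Noise A W) (m : Option (Fin W)) (i : Fin A)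
    (t : ℝ) :
    (s.step τ α ε k x).expWeight M m i t = s.expWeight M m i t *
      if (s.decide τ α ε k x).arm m = i then
        ENNReal.ofReal (Real.exp (t * (x.1 m i - (M.task m).mean i) - t ^ 2 / 8)) else 1 := by
  unfold expWeight step
  split_ifs with h
  · rw [← ENNReal.ofReal_mul (Real.exp_nonneg _), ← Real.exp_add]
    simp only [h, if_true]
    push_cast
    ring_nf
  · simp [h]

/-- The choices of an iteration do not depend on its rewards, so the rewards can be integrated out
first. -/
theorem lintegral_expWeight_step_le (s : State A W) (k : ℕ) (m : Option (Fin W)) (i : Fin A)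
    (t : ℝ) :
    ∫⁻ x, (s.step τ α ε k x).expWeight M m i t ∂M.noiseLaw ≤ s.expWeight M m i t := by
  have hmeas : Measurable fun x : Noise A W => (s.step τ α ε k x).expWeight M m i t :=
    (measurable_expWeight M m i t).comp ((measurable_step τ α ε k).comp measurable_prodMk_left)
  have hreward : MeasurePreserving (fun r : Option (Fin W) → Fin A → ℝ => r m i)
      (Measure.pi fun m => Measure.pi fun i => (M.task m).law i) ((M.task m).law i) :=
    (measurePreserving_eval (fun i => (M.task m).law i) i).comp
      (measurePreserving_eval (fun m => Measure.pi fun i => (M.task m).law i) m)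
  rw [Problem.noiseLaw, lintegral_prod_symm' _ hmeas]
  refine (lintegral_mono (g := fun _ => s.expWeight M m i t) fun draw => ?_).trans (by simp)
  simp only [expWeight_step]
  rw [lintegral_const_mul' (s.expWeight M m i t) _ ENNReal.ofReal_ne_top]
  refine mul_le_of_le_one_right' ?_
  change ∫⁻ r : Option (Fin W) → Fin A → ℝ, (if (s.decide τ α ε k (0, draw)).arm m = i then
    ENNReal.ofReal (Real.exp (t * (r m i - (M.task m).mean i) - t ^ 2 / 8)) else 1) ∂_ ≤ 1
  split_ifs
  · rw [hreward.lintegral_comp (f := fun y => ENNReal.ofReal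
      (Real.exp (t * (y - (M.task m).mean i) - t ^ 2 / 8))) (by fun_prop)]
    exact (M.task m).lintegral_exp_le_one i t
  · simp

end State

theorem lintegral_expWeight_le_one (n : ℕ) (m : Option (Fin W)) (i : Fin A) (t : ℝ) :
    ∫⁻ ω, (stateAfter τ α ε ω n).expWeight M m i t ∂M.P ≤ 1 := by
  induction n with
  | zero => simp [stateAfter, State.initial, State.expWeight]
  | succ n ih =>
    have hstep : Measurable fun p : State A W × Noise A W =>
        (p.1.step τ α ε (n + 1) p.2).expWeight M m i t :=
      (State.measurable_expWeight M m i t).comp (measurable_step τ α ε (n + 1))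
    calc ∫⁻ ω, (stateAfter τ α ε ω (n + 1)).expWeight M m i t ∂M.P
        = ∫⁻ p, (p.1.step τ α ε (n + 1) p.2).expWeight M m i t
            ∂(M.P.map fun ω => (stateAfter τ α ε ω n, ω (n + 1))) :=
          (lintegral_map hstep
            ((measurable_stateAfter τ α ε n).prodMk (measurable_pi_apply _))).symm
      _ = ∫⁻ s, ∫⁻ x, (s.step τ α ε (n + 1) x).expWeight M m i t ∂M.noiseLaw
            ∂(M.P.map fun ω => stateAfter τ α ε ω n) := by
          rw [map_stateAfter_prod, lintegral_prod _ hstep.aemeasurable]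
      _ ≤ ∫⁻ s, s.expWeight M m i t ∂(M.P.map fun ω => stateAfter τ α ε ω n) :=
          lintegral_mono fun s => s.lintegral_expWeight_step_le M τ α ε (n + 1) m i t
      _ = ∫⁻ ω, (stateAfter τ α ε ω n).expWeight M m i t ∂M.P :=
          lintegral_map (State.measurable_expWeight M m i t) (measurable_stateAfter τ α ε n)
      _ ≤ 1 := ih

theorem measureReal_le_exp_neg (n : ℕ) (m : Option (Fin W)) (i : Fin A) (t u : ℝ) :
    M.P.real {ω | u ≤ t * ((stateAfter τ α ε ω n).total m i -
      (M.task m).mean i * (stateAfter τ α ε ω n).count m i) -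
        t ^ 2 / 8 * (stateAfter τ α ε ω n).count m i} ≤ Real.exp (-u) := by
  have hmeas : Measurable fun ω : ℕ → Noise A W => (stateAfter τ α ε ω n).expWeight M m i t :=
    (State.measurable_expWeight M m i t).comp (measurable_stateAfter τ α ε n)
  have hmarkov := (mul_meas_ge_le_lintegral hmeas (μ := M.P) (ENNReal.ofReal (Real.exp u))).trans
    (lintegral_expWeight_le_one M τ α ε n m i t)
  simp only [State.expWeight, ENNReal.ofReal_le_ofReal_iff (Real.exp_nonneg _),
    Real.exp_le_exp] at hmarkov
  refine ENNReal.toReal_le_of_le_ofReal (Real.exp_nonneg _) ?_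
  rwa [Real.exp_neg, ENNReal.ofReal_inv_of_pos (Real.exp_pos u), ENNReal.le_inv_iff_mul_le,
    mul_comm]

theorem measureReal_count_eq_and_le_abs_sub_le (n : ℕ) (m : Option (Fin W)) (i : Fin A) {c : ℕ}
    (hc : 0 < c) {v : ℝ} (hv : 0 ≤ v) :
    M.P.real {ω | (stateAfter τ α ε ω n).count m i = c ∧
      v ≤ |(stateAfter τ α ε ω n).empMean m i - (M.task m).mean i|} ≤
      2 * Real.exp (-(2 * c * v ^ 2)) := by
  have : (0 : ℝ) < c := Nat.cast_pos.2 hc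
  rw [two_mul (Real.exp _)]
  -- The exponent `c (t v - t² / 8)` for the upper tail is maximal at `t = 4 v`.
  refine ((measureReal_mono ?_).trans (measureReal_union_le _ _)).trans
    (add_le_add (measureReal_le_exp_neg M τ α ε n m i (4 * v) (2 * c * v ^ 2))
      (measureReal_le_exp_neg M τ α ε n m i (-(4 * v)) (2 * c * v ^ 2)))
  rintro ω ⟨hcount, habs⟩
  rw [State.empMean, hcount] at habs
  simp only [Set.mem_union, Set.mem_ofPred_eq, hcount]
  set S := (stateAfter τ α ε ω n).total m i
  set μ := (M.task m).mean i
  have hS : S - μ * c = (S / c - μ) * c := by field_simp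
  have hcv : 0 ≤ c * v := by positivity
  rw [hS]
  rcases le_abs.1 habs with h | h
  · left
    nlinarith [mul_le_mul_of_nonneg_left h hcv]
  · right
    nlinarith [mul_le_mul_of_nonneg_left h hcv]

theorem confLevel_rpow_eq_exp (A W k : ℕ) (p : ℝ) :
    confLevel A W k ^ p = Real.exp (Real.log (confLevel A W k) * p) :=
  Real.rpow_def_of_pos (zero_lt_one.trans_le (one_le_confLevel A W k)) p

variable {α}

theorem measureReal_count_eq_and_width_lt_le (hα : 0 ≤ α) (n k : ℕ) (m : Option (Fin W))
    (i : Fin A) {c : ℕ} (hc : 0 < c) :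
    M.P.real {ω | (stateAfter τ α ε ω n).count m i = c ∧ (stateAfter τ α ε ω n).width α k m i <
      |(stateAfter τ α ε ω n).empMean m i - (M.task m).mean i|} ≤
      2 * confLevel A W k ^ (-(4 * α)) := by
  have hc' : (c : ℝ) ≠ 0 := Nat.cast_ne_zero.2 hc.ne'
  have hlog := log_confLevel_nonneg A W k
  have hexponent : 2 * c * √(2 * α * Real.log (confLevel A W k) / c) ^ 2 =
      Real.log (confLevel A W k) * (4 * α) := by
    rw [Real.sq_sqrt (by positivity)]
    field_simp
    ring
  rw [confLevel_rpow_eq_exp, mul_neg, ← hexponent]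
  refine (measureReal_mono ?_).trans
    (measureReal_count_eq_and_le_abs_sub_le M τ α ε n m i hc (Real.sqrt_nonneg _))
  rintro ω ⟨hcount, hlt⟩
  exact ⟨hcount, by simpa only [State.width, hcount] using hlt.le⟩

theorem measureReal_not_accurate_le (hα : 0 ≤ α) {n : ℕ} (hn : A ≤ n) (k : ℕ) :
    M.P.real {ω | ¬ (stateAfter τ α ε ω n).Accurate M α k} ≤
      (W + 1) * (A * (n * (2 * confLevel A W k ^ (-(4 * α))))) := by
  let fails (m : Option (Fin W)) (i : Fin A) (c : ℕ) : Set (ℕ → Noise A W) :=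
    {ω | (stateAfter τ α ε ω n).count m i = c ∧ (stateAfter τ α ε ω n).width α k m i <
      |(stateAfter τ α ε ω n).empMean m i - (M.task m).mean i|}
  have hsub : {ω | ¬ (stateAfter τ α ε ω n).Accurate M α k} ⊆
      ⋃ m, ⋃ i, ⋃ c ∈ Finset.Icc 1 n, fails m i c := by
    intro ω hω
    simp only [State.Accurate, not_forall, not_le, Set.mem_ofPred_eq] at hω
    obtain ⟨m, i, h⟩ := hω
    have hle : (stateAfter τ α ε ω n).count m i ≤ n :=
      (count_stateAfter τ α ε ω n m i).trans_le (Nat.count_le _)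
    simp only [Set.mem_iUnion]
    exact ⟨m, i, _, Finset.mem_Icc.2 ⟨count_stateAfter_pos τ α ε ω hn m i, hle⟩, rfl, h⟩
  calc M.P.real {ω | ¬ (stateAfter τ α ε ω n).Accurate M α k}
      ≤ M.P.real (⋃ m, ⋃ i, ⋃ c ∈ Finset.Icc 1 n, fails m i c) := measureReal_mono hsub
    _ ≤ ∑ m : Option (Fin W), ∑ i : Fin A, ∑ c ∈ Finset.Icc 1 n, M.P.real (fails m i c) :=
      (measureReal_iUnion_fintype_le _).trans <| Finset.sum_le_sum fun m _ =>
        (measureReal_iUnion_fintype_le _).trans <| Finset.sum_le_sum fun i _ =>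
          measureReal_biUnion_finset_le _ _
    _ ≤ ∑ m : Option (Fin W), ∑ i : Fin A, ∑ c ∈ Finset.Icc 1 n,
        2 * confLevel A W k ^ (-(4 * α)) :=
      Finset.sum_le_sum fun m _ => Finset.sum_le_sum fun i _ => Finset.sum_le_sum fun c hc =>
        measureReal_count_eq_and_width_lt_le M τ ε hα n k m i (Finset.mem_Icc.1 hc).1
    _ = (W + 1) * (A * (n * (2 * confLevel A W k ^ (-(4 * α))))) := by simp

theorem ae_draw_mem : ∀ᵐ ω ∂M.P, ∀ n S, (ω n).2 S ∈ S.1 := by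
  refine ae_all_iff.2 fun n => ae_all_iff.2 fun S => ?_
  have hnoise : MeasurePreserving (fun ω : ℕ → Noise A W => ω n) M.P M.noiseLaw :=
    measurePreserving_eval_infinitePi (fun _ : ℕ => M.noiseLaw) n
  have hdraw : MeasurePreserving (fun ω : ℕ → Noise A W => (ω n).2 S) M.P
      (PMF.uniformOfFinset S.1 S.2).toMeasure :=
    (measurePreserving_eval (fun S : Cand W => (PMF.uniformOfFinset S.1 S.2).toMeasure) S).comp
      (measurePreserving_snd.comp hnoise)
  refine hdraw.quasiMeasurePreserving.ae (p := fun w => w ∈ S.1) ?_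
  rw [ae_iff, PMF.toMeasure_apply_eq_zero_iff _ (Set.toFinite _).measurableSet,
    PMF.support_uniformOfFinset]
  exact Set.disjoint_left.2 fun w hw hw' => hw' hw

end Concentration

/-! ### The threshold on `k` and the failure probability -/

theorem log_le_div_add_log {x c : ℝ} (hx : 0 < x) (hc : 0 < c) :
    Real.log x ≤ x / c + Real.log c := by
  have h := Real.log_le_sub_one_of_pos (div_pos hx hc)
  rw [Real.log_div hx.ne' hc.ne'] at h
  linarith

theorem confLevel_le_pow_mul_sq {X : ℝ} (hX : 2 ≤ X) (hAW : (A : ℝ) * W ≤ X) {k : ℕ}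
    (hk : 1 ≤ k) : confLevel A W k ≤ X ^ 9 * (k : ℝ) ^ 2 := by
  have hk' : (1 : ℝ) ≤ k := mod_cast hk
  have hWA : (W : ℝ) * A ^ 2 ≤ X ^ 2 := by
    calc (W : ℝ) * A ^ 2 ≤ W ^ 2 * A ^ 2 := by
          gcongr
          exact_mod_cast Nat.le_self_pow two_ne_zero W
      _ = ((A : ℝ) * W) ^ 2 := by ring
      _ ≤ X ^ 2 := by gcongr
  have hXk : 1 ≤ X ^ 2 * (k : ℝ) ^ 2 :=
    one_le_mul_of_one_le_of_one_le (one_le_pow₀ (by linarith)) (one_le_pow₀ hk')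
  calc confLevel A W k = 1 + 16 * (W * (A : ℝ) ^ 2) * ((k : ℝ) + 1) ^ 2 := by
        rw [confLevel]
        ring
    _ ≤ X ^ 2 * (k : ℝ) ^ 2 + 16 * X ^ 2 * (2 * k) ^ 2 := by
        gcongr
        linarith
    _ = 65 * (X ^ 2 * (k : ℝ) ^ 2) := by ring
    _ ≤ 2 ^ 7 * (X ^ 2 * (k : ℝ) ^ 2) := by
        gcongr
        norm_num
    _ ≤ X ^ 7 * (X ^ 2 * (k : ℝ) ^ 2) := by gcongr
    _ = X ^ 9 * (k : ℝ) ^ 2 := by ring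

theorem log_confLevel_le {X B : ℝ} (hX : 2 ≤ X) (hAW : (A : ℝ) * W ≤ X) (hB : 0 < B)
    (hBX : B ≤ X ^ 2) {k : ℕ} (hk : 1 ≤ k) :
    Real.log (confLevel A W k) ≤ 43 * Real.log X + k / (2 ^ 14 * B) := by
  have hk' : (0 : ℝ) < k := mod_cast hk
  have : 0 < X := by linarith
  have hlogB : Real.log (2 ^ 15 * B) ≤ 17 * Real.log X := by
    calc Real.log (2 ^ 15 * B) ≤ Real.log (X ^ 15 * X ^ 2) := by gcongr
      _ = 17 * Real.log X := by
        rw [← pow_add, Real.log_pow]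
        norm_num
  have hlogk := log_le_div_add_log hk' (by positivity : 0 < 2 ^ 15 * B)
  calc Real.log (confLevel A W k) ≤ Real.log (X ^ 9 * (k : ℝ) ^ 2) :=
        Real.log_le_log (zero_lt_one.trans_le (one_le_confLevel A W k))
          (confLevel_le_pow_mul_sq hX hAW hk)
    _ = 9 * Real.log X + 2 * Real.log k := by
        rw [Real.log_mul (by positivity) (by positivity), Real.log_pow, Real.log_pow]
        norm_num
    _ ≤ 9 * Real.log X + 2 * (k / (2 ^ 15 * B) + 17 * Real.log X) := by
        gcongr
        exact hlogk.trans (by gcongr)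
    _ = 43 * Real.log X + k / (2 ^ 14 * B) := by
        field_simp
        ring

theorem mul_pullBound_add_one_le {α Δ : ℝ} {k : ℕ} (hA : 2 ≤ A) (hW : 1 ≤ W) (hα : 1 ≤ α)
    (hΔ : 0 < Δ) (hΔ1 : Δ ≤ 1)
    (hk : 2 ^ 20 * (α * A / Δ ^ 2) * Real.log (α * A * W / Δ) ≤ k) :
    16 * (A * (pullBound A W α (Δ / 16) k + 1)) ≤ k := by
  have hA' : (2 : ℝ) ≤ A := mod_cast hA
  have hW' : (1 : ℝ) ≤ W := mod_cast hW
  have hαA : (A : ℝ) ≤ α * A := le_mul_of_one_le_left (by positivity) hα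
  have hαAW : α * A ≤ α * A * W := le_mul_of_one_le_right (by positivity) hW'
  have hpull : A * pullBound A W α (Δ / 16) k =
      512 * (α * A / Δ ^ 2) * Real.log (confLevel A W k) := by
    rw [pullBound]
    field_simp
    ring
  have hXΔ : α * A * W ≤ α * A * W / Δ := le_div_self (by positivity) hΔ hΔ1
  have hAW : (A : ℝ) * W ≤ α * A * W / Δ := le_trans (by gcongr) hXΔ
  have hAB : (A : ℝ) ≤ α * A / Δ ^ 2 :=
    hαA.trans (le_div_self (by positivity) (by positivity) (pow_le_one₀ hΔ.le hΔ1))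
  have hBX : α * A / Δ ^ 2 ≤ (α * A * W / Δ) ^ 2 := by
    rw [div_pow]
    gcongr
    exact hαAW.trans (le_self_pow₀ (by linarith) two_ne_zero)
  set X := α * A * W / Δ
  set B := α * A / Δ ^ 2
  have hX : 2 ≤ X := by linarith
  have hB : 0 < B := by linarith
  have hlogX : 1 / 2 ≤ Real.log X := by
    have := Real.log_le_log two_pos hX
    linarith [Real.log_two_gt_d9]
  have hBl : B / 2 ≤ B * Real.log X := by nlinarith
  have hk1 : 1 ≤ k := Nat.one_le_cast.1 (by linarith : (1 : ℝ) ≤ k)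
  have hlog := mul_le_mul_of_nonneg_left (log_confLevel_le hX hAW hB hBX hk1) hB.le
  have hcancel : B * (k / (2 ^ 14 * B)) = k / 2 ^ 14 := by field_simp
  linarith

theorem mul_sq_le_confLevel (hA : 2 ≤ A) {n k : ℕ} (hk : k ≤ 8 * (n + 1)) :
    W * (k : ℝ) ^ 2 ≤ confLevel A W n := by
  have hA' : (2 : ℝ) ≤ A := mod_cast hA
  have hk' : (k : ℝ) ≤ 8 * (n + 1) := mod_cast hk
  calc W * (k : ℝ) ^ 2 ≤ W * (8 * (n + 1)) ^ 2 := by gcongr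
    _ = 16 * W * (2 : ℝ) ^ 2 * (n + 1) ^ 2 := by ring
    _ ≤ 16 * W * (A : ℝ) ^ 2 * (n + 1) ^ 2 := by gcongr
    _ ≤ confLevel A W n := le_add_of_nonneg_left zero_le_one

theorem confLevel_rpow_le {α : ℝ} (hA : 2 ≤ A) (hW : 1 ≤ W) (hα : 1 ≤ 4 * α) {n k : ℕ}
    (hk0 : 0 < k) (hk : k ≤ 8 * (n + 1)) :
    confLevel A W n ^ (-(4 * α)) ≤ (W : ℝ)⁻¹ * (k : ℝ) ^ (-(8 * α)) := by
  have hW' : (1 : ℝ) ≤ W := mod_cast hW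
  have hk' : (0 : ℝ) < k := mod_cast hk0
  calc confLevel A W n ^ (-(4 * α)) ≤ (W * (k : ℝ) ^ 2) ^ (-(4 * α)) :=
        Real.rpow_le_rpow_of_nonpos (by positivity) (mul_sq_le_confLevel hA hk) (by linarith)
    _ = (W : ℝ) ^ (-(4 * α)) * (k : ℝ) ^ (-(8 * α)) := by
        rw [Real.mul_rpow (by positivity) (by positivity), ← Real.rpow_natCast_mul hk'.le]
        ring_nf
    _ ≤ (W : ℝ) ^ (-1 : ℝ) * (k : ℝ) ^ (-(8 * α)) := by gcongr
    _ = (W : ℝ)⁻¹ * (k : ℝ) ^ (-(8 * α)) := by rw [Real.rpow_neg_one]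

section ErrorProbability

variable {M : Problem A W} {τ : TieBreak A W} {α ε : ℝ} {opt : Option (Fin W) → Fin A} {Δ : ℝ}

theorem measureReal_not_accurate_le_rpow (hA : 2 ≤ A) (hW : 1 ≤ W) (hα : 1 ≤ 4 * α) {n k : ℕ}
    (hAn : A ≤ n) (hnk : n < k) (hkn : k ≤ 8 * (n + 2)) :
    M.P.real {ω | ¬ (stateAfter τ α ε ω n).Accurate M α (n + 1)} ≤
      4 * A * (k : ℝ) ^ (1 - 8 * α) := by
  have hW' : (1 : ℝ) ≤ W := mod_cast hW
  have hk : (0 : ℝ) < k := mod_cast (by omega : 0 < k)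
  have hW2 : ((W : ℝ) + 1) * (W : ℝ)⁻¹ ≤ 2 := by
    rw [← div_eq_mul_inv, div_le_iff₀ (by linarith)]
    linarith
  calc M.P.real {ω | ¬ (stateAfter τ α ε ω n).Accurate M α (n + 1)}
      ≤ (W + 1) * (A * (n * (2 * confLevel A W (n + 1) ^ (-(4 * α))))) :=
        measureReal_not_accurate_le M τ ε (by linarith) hAn (n + 1)
    _ ≤ (W + 1) * (A * (k * (2 * ((W : ℝ)⁻¹ * (k : ℝ) ^ (-(8 * α)))))) := by
        have hnonneg := Real.rpow_nonneg
          (zero_le_one.trans (one_le_confLevel A W (n + 1))) (-(4 * α))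
        have hle := confLevel_rpow_le hA hW hα (by omega) hkn
        gcongr
    _ = (W + 1) * (W : ℝ)⁻¹ * (2 * A * (k * (k : ℝ) ^ (-(8 * α)))) := by ring
    _ ≤ 2 * (2 * A * (k * (k : ℝ) ^ (-(8 * α)))) := by gcongr
    _ = 4 * A * (k : ℝ) ^ (1 - 8 * α) := by
        rw [sub_eq_add_neg, Real.rpow_add hk, Real.rpow_one]
        ring

theorem ae_armHi_eq_of_forall_accurate (hM : M.IsTransferable opt Δ ε) (hα : 0 ≤ α) (hA : 2 ≤ A)
    {k : ℕ} (hAk : A ≤ k / 8) (hk : 16 * (A * (pullBound A W α (Δ / 16) k + 1)) ≤ k) :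
    ∀ᵐ ω ∂M.P, (∀ n ∈ Finset.Ico (k / 8) k, (stateAfter τ α ε ω n).Accurate M α (n + 1)) →
      armHi τ α ε k ω = opt none := by
  filter_upwards [ae_draw_mem M] with ω hdraw haccurate
  have hrun : FavorableRun M τ α ε ω (k / 8) (k - 1) :=
    ⟨hAk, hdraw, fun n hn hnk => haccurate n (Finset.mem_Ico.2 ⟨hn, by omega⟩)⟩
  exact hrun.armHi_eq hM hα hA hk

theorem measureReal_armHi_ne_le (hM : M.IsTransferable opt Δ ε) (hα : 1 ≤ 4 * α) (hA : 2 ≤ A)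
    (hW : 1 ≤ W) {k : ℕ} (hk : 16 * (A * (pullBound A W α (Δ / 16) k + 1)) ≤ k) :
    M.P.real {ω | armHi τ α ε k ω ≠ opt none} ≤ 4 * (A / (k : ℝ) ^ (8 * α - 2)) := by
  have hα0 : 0 ≤ α := by linarith
  have hA16 : 16 * A ≤ k := by
    have := mul_nonneg (Nat.cast_nonneg (α := ℝ) A)
      (pullBound_nonneg (A := A) (W := W) hα0 (Δ / 16) k)
    have : (16 : ℝ) * A ≤ k := by linarith
    exact_mod_cast this
  have hAk : A ≤ k / 8 := by omega
  have hk0 : (0 : ℝ) < k := mod_cast (by omega : 0 < k)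
  have hsub : {ω | armHi τ α ε k ω ≠ opt none} ≤ᵐ[M.P] ⋃ n ∈ Finset.Ico (k / 8) k,
      {ω | ¬ (stateAfter τ α ε ω n).Accurate M α (n + 1)} := by
    filter_upwards [ae_armHi_eq_of_forall_accurate (τ := τ) hM hα0 hA hAk hk] with ω himp hω
    have hinaccurate := mt himp hω
    push Not at hinaccurate
    obtain ⟨n, hn, hacc⟩ := hinaccurate
    exact Set.mem_biUnion hn hacc
  calc M.P.real {ω | armHi τ α ε k ω ≠ opt none}
      ≤ M.P.real (⋃ n ∈ Finset.Ico (k / 8) k,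
          {ω | ¬ (stateAfter τ α ε ω n).Accurate M α (n + 1)}) :=
        ENNReal.toReal_mono (measure_ne_top _ _) (measure_mono_ae hsub)
    _ ≤ ∑ n ∈ Finset.Ico (k / 8) k, 4 * A * (k : ℝ) ^ (1 - 8 * α) :=
        (measureReal_biUnion_finset_le _ _).trans <| Finset.sum_le_sum fun n hn => by
          rw [Finset.mem_Ico] at hn
          exact measureReal_not_accurate_le_rpow hA hW hα (by omega) hn.2 (by omega)
    _ = (k - k / 8 : ℕ) * (4 * A * (k : ℝ) ^ (1 - 8 * α)) := by simp
    _ ≤ k * (4 * A * (k : ℝ) ^ (1 - 8 * α)) := by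
        gcongr
        exact Nat.sub_le _ _
    _ = 4 * (A * ((k : ℝ) ^ (1 - 8 * α) * k)) := by ring
    _ = 4 * (A / (k : ℝ) ^ (8 * α - 2)) := by
        rw [← Real.rpow_add_one hk0.ne', div_eq_mul_inv, ← Real.rpow_neg hk0.le]
        ring_nf

end ErrorProbability

theorem div_rpow_le_div_rpow {a p q : ℝ} (ha : 0 ≤ a) (hp : 0 < p) (hpq : p ≤ q) (k : ℕ) :
    a / (k : ℝ) ^ q ≤ a / (k : ℝ) ^ p := by
  rcases Nat.eq_zero_or_pos k with rfl | hk
  · rw [Nat.cast_zero, Real.zero_rpow hp.ne', Real.zero_rpow (hp.trans_le hpq).ne']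
  · have hk' : (1 : ℝ) ≤ k := mod_cast hk
    gcongr

end TieredBandit

end

theorem mainTheorem7_general :
    ∃ cStar : ℝ, 0 < cStar ∧ ∃ C : ℝ, 0 < C ∧
      ∀ (A W : ℕ) (M : TieredBandit.Problem A W) (τ : TieredBandit.TieBreak A W)
        (ε α : ℝ) (iHi : Fin A),
        M.UniqueOptimalArms →
        M.OptimalValueDominance →
        0 < M.minGap →
        ε ≤ M.minGap / 4 →
        1 ≤ α →
        (∃ w, M.IsClose ε w) →
        M.hi.IsOptimalArm iHi →
        ∀ k : ℕ,
          cStar * (α * A / M.minGap ^ 2) * Real.log (α * A * W / M.minGap) ≤ (k : ℝ) →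
          M.P.real {ω | TieredBandit.armHi τ α ε k ω ≠ iHi} ≤
            C * (A / (k : ℝ) ^ (8 * α - 2)) := by
  refine ⟨2 ^ 20, by norm_num, 4, by norm_num, ?_⟩
  intro A W M τ ε α iHi huniq hdom hgap hε hα hclose hiHi k hk
  obtain ⟨opt, hopt, hM⟩ :=
    TieredBandit.Problem.exists_isTransferable huniq hdom hgap hε hclose
  obtain rfl : iHi = opt none := (hopt none iHi).1 hiHi
  have hA : 2 ≤ A := TieredBandit.Problem.two_le_arms hgap
  have hW : 1 ≤ W := hclose.elim fun w _ => w.pos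
  exact TieredBandit.measureReal_armHi_ne_le hM (by linarith) hA hW
    (TieredBandit.mul_pullBound_add_one_le hA hW hα hgap
      (TieredBandit.Problem.minGap_le_one hgap) hk)

theorem mainTheorem7 :
    ∃ cStar : ℝ, 0 < cStar ∧ ∃ C : ℝ, 0 < C ∧
      ∀ (A W : ℕ) (M : TieredBandit.Problem A W) (τ : TieredBandit.TieBreak A W)
        (Δt α : ℝ) (iHi : Fin A),
        M.UniqueOptimalArms →
        M.OptimalValueDominance →
        0 < M.minGap →
        0 ≤ Δt → Δt ≤ M.minGap →
        2 < α →
        (∃ w, M.IsClose (Δt / 4) w) →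
        M.hi.IsOptimalArm iHi →
        ∀ k : ℕ,
          cStar * (α * A / M.minGap ^ 2) * Real.log (α * A * W / M.minGap) ≤ (k : ℝ) →
          M.P.real {ω | TieredBandit.armHi τ α (Δt / 4) k ω ≠ iHi} ≤
            C * (A / (k : ℝ) ^ (2 * α - 2)) := by
  obtain ⟨cStar, hcStar, C, hC, hbound⟩ := mainTheorem7_general
  refine ⟨cStar, hcStar, C, hC, ?_⟩
  intro A W M τ Δt α iHi huniq hdom hgap _ hΔt hα hclose hiHi k hk
  calc M.P.real {ω | TieredBandit.armHi τ α (Δt / 4) k ω ≠ iHi}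
      ≤ C * (A / (k : ℝ) ^ (8 * α - 2)) :=
        hbound A W M τ (Δt / 4) α iHi huniq hdom hgap (by linarith) (by linarith) hclose hiHi k hk
    _ ≤ C * (A / (k : ℝ) ^ (2 * α - 2)) := by
        gcongr ?_ * ?_
        exact TieredBandit.div_rpow_le_div_rpow A.cast_nonneg (by linarith) (by linarith) k
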